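/- For integers $n\ge 2$ let $L_{n,n}$ be the $n\times n$ grid graph, that is, the Cartesian product of two paths with $n$ vertices each. For a finite connected graph $G$ with $N\ge 2$ vertices and an integer $h\ge 1$, let $\mathrm{Lip}(G;h)$ be the set of functions $f:V(G)\to\mathbb{Z}$ such that $f(v)=0$ at one fixed vertex $v$ and $|f(x)-f(y)|\le h$ for every edge $\{x,y\}$ of $G$ (its size does not depend on $v$), and let $$c(G)=\lim_{h\to\infty}\frac1h\,\bigl|\mathrm{Lip}(G;h)\bigr|^{1/(N-1)}.$$ Let $\alpha\approx 1.16234$ be the largest real solution of $\tan(1/x)=x$. Then the limit $c(L_{n,n})$ exists for every $n\ge 2$, the limit $\lim_{n\to\infty}c(L_{n,n})$ exists, and $$\lim_{n\to\infty}c(L_{n,n})\ \ge\ \alpha^2\approx 1.35103.$$ -/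

import Mathlib

namespace LipschitzGrid

open Filter Topology

/-- The integer-valued `h`-Lipschitz functions on the graph `G` that vanish at all vertices of the
set `R` of roots.  For a connected graph and `R = {v}` this is `Lip_v(G; h)`. -/
def lipFunctions {V : Type*} (G : SimpleGraph V) (R : Set V) (h : ℕ) : Set (V → ℤ) :=
  {f | (∀ v ∈ R, f v = 0) ∧ ∀ x y, G.Adj x y → |f x - f y| ≤ (h : ℤ)}

/-- A set of roots with exactly one vertex in each connected component of `G`. -/
noncomputable def roots {V : Type*} (G : SimpleGraph V) : Set V :=
  Set.range (fun C : G.ConnectedComponent => Quot.out C)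

/-- `|Lip(G; h)|`: the number of `h`-Lipschitz functions on `G` that vanish at one fixed vertex
of each connected component. -/
noncomputable def lipCount {V : Type*} (G : SimpleGraph V) (h : ℕ) : ℕ :=
  (lipFunctions G (roots G) h).ncard

/-- `(1 / h) * |Lip(G; h)| ^ (1 / (n - k))`, where `n` is the number of vertices and `k` the number
of connected components of `G`. -/
noncomputable def lipRate {V : Type*} (G : SimpleGraph V) (h : ℕ) : ℝ :=
  (1 / (h : ℝ)) *
    (lipCount G h : ℝ) ^ (1 / ((Nat.card V : ℝ) - (Nat.card G.ConnectedComponent : ℝ)))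

/-- `c(G)`, the limit of `lipRate G h` as `h → ∞`. -/
noncomputable def lipConst {V : Type*} (G : SimpleGraph V) : ℝ :=
  limUnder atTop (lipRate G)

/-- The `m × n` grid graph `L_{m,n}`: the Cartesian product of the paths with `m` and `n`
vertices. -/
def grid (m n : ℕ) : SimpleGraph (Fin m × Fin n) :=
  (SimpleGraph.pathGraph m).boxProd (SimpleGraph.pathGraph n)

/-- On a walk of length `l` an `h`-Lipschitz function changes by at most `l * h`. -/
theorem abs_sub_le_of_walk {V : Type*} {G : SimpleGraph V} {h : ℕ} {f : V → ℤ}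
    (hf : ∀ x y, G.Adj x y → |f x - f y| ≤ (h : ℤ)) {u v : V} (p : G.Walk u v) :
    |f u - f v| ≤ (p.length : ℤ) * h := by
  induction p with
  | nil => simp
  | @cons a b c hab p ih =>
    have h1 := hf a b hab
    have h2 := abs_sub_le (f a) (f b) (f c)
    rw [SimpleGraph.Walk.length_cons]
    push_cast
    linarith

/-- On a finite graph the set counted by `lipCount` is finite, so its `ncard` is its size. -/
theorem finite_lipFunctions_roots {V : Type*} [Finite V] (G : SimpleGraph V) (h : ℕ) :
    (lipFunctions G (roots G) h).Finite := by
  have key : ∀ v : V, ∃ N : ℤ, ∀ f ∈ lipFunctions G (roots G) h, |f v| ≤ N := by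
    intro v
    have hr : G.Reachable v (Quot.out (G.connectedComponentMk v)) :=
      SimpleGraph.ConnectedComponent.exact (Quot.out_eq (G.connectedComponentMk v)).symm
    obtain ⟨p⟩ := hr
    refine ⟨(p.length : ℤ) * h, fun f hf => ?_⟩
    have h1 := abs_sub_le_of_walk hf.2 p
    rwa [hf.1 _ ⟨_, rfl⟩, sub_zero] at h1
  choose N hN using key
  refine (Set.Finite.pi' (fun v => Set.finite_Icc (-N v) (N v))).subset ?_
  intro f hf v
  exact abs_le.mp (hN v f hf)

/-- For a connected graph the count does not depend on the root. -/
theorem lipCount_eq_of_connected {V : Type*} {G : SimpleGraph V} (hG : G.Connected) (v : V)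
    (h : ℕ) : lipCount G h = (lipFunctions G {v} h).ncard := by
  obtain ⟨w, hw⟩ : ∃ w, roots G = {w} := by
    refine ⟨Quot.out (G.connectedComponentMk v), ?_⟩
    ext x
    constructor
    · rintro ⟨C, rfl⟩
      have : C = G.connectedComponentMk v := by
        induction C using SimpleGraph.ConnectedComponent.ind with
        | h u => exact SimpleGraph.ConnectedComponent.sound (hG.preconnected u v)
      rw [this]
      rfl
    · rintro rfl
      exact ⟨_, rfl⟩
  unfold lipCount
  rw [hw]
  refine Set.ncard_congr (fun f _ x => f x - f v) ?_ ?_ ?_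
  · rintro f ⟨-, hf⟩
    refine ⟨by simp, fun x y hxy => ?_⟩
    simpa using hf x y hxy
  · rintro f g ⟨hf, -⟩ ⟨hg, -⟩ hfg
    have hfw : f w = 0 := hf w rfl
    have hgw : g w = 0 := hg w rfl
    have h0 := congrFun hfg w
    simp only [hfw, hgw] at h0
    ext x
    have h1 := congrFun hfg x
    linarith
  · rintro g ⟨hg, hg'⟩
    have hgv : g v = 0 := hg v rfl
    refine ⟨fun x => g x - g w, ⟨by simp, fun x y hxy => by simpa using hg' x y hxy⟩, ?_⟩
    ext x
    simp [hgv]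

end LipschitzGrid

/-!
For a connected graph `G` with `N` vertices, `|Lip(G; h)| / h ^ (N - 1)` counts the points of the
lattice `h⁻¹ ℤ ^ (N - 1)` in the polytope of real `1`-Lipschitz functions vanishing at a root, and
so converges to the volume of this convex body (`tendsto_lipVolume`); `c(G)` is the `(N - 1)`-st
root of that volume (`lipConst_eq`).

Cutting a grid into two can only multiply the count by a bounded factor: the volume `V(m, n)` of
`L_{m,n}` satisfies `V(m₁ + m₂, n) ≤ 2 V(m₁, n) V(m₂, n)`, and likewise in `n`.  Hence
`log (2 V(m, n))` is subadditive in each variable, it is nonnegative, and Fekete's argument gives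
the limit along the diagonal (`exists_tendsto_diag_of_subadditive`).

For the lower bound, view `V(m + 1, n)` as `⟨1, T ^ m 1⟩` for the symmetric row-to-row transfer
operator `T`.  By Cauchy–Schwarz, `V(j + 1, n) ^ 2 ≤ V(1, n) V(2 j + 1, n)`, so that repeated
doubling bounds `V(2 ^ k + 1, n)` from below in terms of the ratio `V(2, n) / V(1, n)`
(`lipVolume_grid_sq_le`, `lipVolume_grid_two_pow_ge`).  The path has `V(1, n) ≤ 2 ^ (n - 1)`.  The
ladder is governed by the operator with kernel `2 - |x - y|` on `[-1, 1]`, whose top eigenfunction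
is `cos (ω x)` with `ω tan ω = 1`, that is `ω = 1 / α`, and whose top eigenvalue is `2 α ^ 2`.  Its
discretization `overlapOp h`, acting on the increments along the rungs, has an explicit cosine as
subeigenfunction for every `h` (`overlapOp_cos_ge`), which yields `V(2, n) ≥ (2 α ^ 2) ^ (n - 1)`.
Therefore `V(n, n) ≥ α ^ (2 (n - 1) ^ 2)` for `n = 2 ^ k + 1`, and the limit is at least `α ^ 2`.
-/

namespace LipschitzGrid

open Filter Topology

/-! ### The constant `α` -/

theorem norm_exp_mul_I_sub_taylor_le {x : ℝ} (hx : |x| ≤ 1) :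
    ‖Complex.exp (x * Complex.I) -
      (((1 - x ^ 2 / 2 + x ^ 4 / 24 - x ^ 6 / 720 + x ^ 8 / 40320 - x ^ 10 / 3628800 : ℝ) : ℂ) +
      ((x - x ^ 3 / 6 + x ^ 5 / 120 - x ^ 7 / 5040 + x ^ 9 / 362880 - x ^ 11 / 39916800 : ℝ) : ℂ)
        * Complex.I)‖ ≤ 1 / 400000000 := by
  have h := Complex.exp_bound (x := x * Complex.I) (n := 12) (by simpa using hx) (by norm_num)
  have hI : Complex.I ^ 2 = -1 := Complex.I_sq
  have h3 : Complex.I ^ 3 = -Complex.I := Complex.I_pow_three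
  have h4 : Complex.I ^ 4 = 1 := Complex.I_pow_four
  have h5 : Complex.I ^ 5 = Complex.I := by rw [pow_succ, h4, one_mul]
  have h6 : Complex.I ^ 6 = -1 := by rw [pow_succ, h5, ← sq, hI]
  have h7 : Complex.I ^ 7 = -Complex.I := by rw [pow_succ, h6]; ring
  have h8 : Complex.I ^ 8 = 1 := by rw [pow_succ, h7, neg_mul, ← sq, hI]; ring
  have h9 : Complex.I ^ 9 = Complex.I := by rw [pow_succ, h8, one_mul]
  have h10 : Complex.I ^ 10 = -1 := by rw [pow_succ, h9, ← sq, hI]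
  have h11 : Complex.I ^ 11 = -Complex.I := by rw [pow_succ, h10]; ring
  refine le_trans (le_of_eq ?_) (h.trans ?_)
  · congr 2
    simp only [Finset.sum_range_succ, Finset.sum_range_zero, Nat.factorial, mul_pow, hI, h3, h4,
      h5, h6, h7, h8, h9, h10, h11]
    push_cast
    ring
  · have h1 : ‖(x : ℂ) * Complex.I‖ ^ 12 ≤ 1 := by
      apply pow_le_one₀ (norm_nonneg _)
      simpa using hx
    calc _ ≤ (1 : ℝ) * ((Nat.succ 12 : ℕ) * ((Nat.factorial 12 : ℕ) * (12 : ℕ) : ℝ)⁻¹) := by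
          gcongr
      _ ≤ _ := by norm_num [Nat.factorial]

theorem abs_cos_sub_taylor_le {x : ℝ} (hx : |x| ≤ 1) :
    |Real.cos x - (1 - x ^ 2 / 2 + x ^ 4 / 24 - x ^ 6 / 720 + x ^ 8 / 40320 - x ^ 10 / 3628800)|
      ≤ 1 / 400000000 := by
  have h := (Complex.abs_re_le_norm _).trans (norm_exp_mul_I_sub_taylor_le hx)
  rwa [Complex.sub_re, Complex.exp_ofReal_mul_I_re, Complex.add_re, Complex.re_ofReal_mul,
    Complex.I_re, mul_zero, add_zero, Complex.ofReal_re] at h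

theorem abs_sin_sub_taylor_le {x : ℝ} (hx : |x| ≤ 1) :
    |Real.sin x - (x - x ^ 3 / 6 + x ^ 5 / 120 - x ^ 7 / 5040 + x ^ 9 / 362880 - x ^ 11 / 39916800)|
      ≤ 1 / 400000000 := by
  have h := (Complex.abs_im_le_norm _).trans (norm_exp_mul_I_sub_taylor_le hx)
  rwa [Complex.sub_im, Complex.exp_ofReal_mul_I_im, Complex.add_im, Complex.im_ofReal_mul,
    Complex.I_im, mul_one, Complex.ofReal_im, zero_add] at h

/-- The reciprocal `ω` of `α`: the root of `x * tan x = 1` in `(0, π / 2)`.  The bounds are fine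
enough to give `α ^ 2 = ω⁻¹ ^ 2` within `5 * 10⁻⁶` of `1.35103`. -/
theorem exists_mul_sin_eq_cos : ∃ ω : ℝ, 0.8603334 < ω ∧ ω < 0.8603360 ∧
    ω * Real.sin ω = Real.cos ω := by
  have hc : Continuous fun x : ℝ => x * Real.sin x - Real.cos x := by fun_prop
  have h1 : (0.8603334 : ℝ) * Real.sin 0.8603334 - Real.cos 0.8603334 < 0 := by
    have hs := abs_le.1 (abs_sin_sub_taylor_le (x := 0.8603334) (by rw [abs_le]; norm_num))
    have hc := abs_le.1 (abs_cos_sub_taylor_le (x := 0.8603334) (by rw [abs_le]; norm_num))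
    norm_num at hs hc ⊢
    linarith [hs.1, hs.2, hc.1, hc.2]
  have h2 : 0 < (0.8603360 : ℝ) * Real.sin 0.8603360 - Real.cos 0.8603360 := by
    have hs := abs_le.1 (abs_sin_sub_taylor_le (x := 0.8603360) (by rw [abs_le]; norm_num))
    have hc := abs_le.1 (abs_cos_sub_taylor_le (x := 0.8603360) (by rw [abs_le]; norm_num))
    norm_num at hs hc ⊢
    linarith [hs.1, hs.2, hc.1, hc.2]
  obtain ⟨ω, hω, h0⟩ := intermediate_value_Ioo (a := (0.8603334 : ℝ)) (b := 0.8603360)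
    (by norm_num) hc.continuousOn ⟨h1, h2⟩
  exact ⟨ω, hω.1, hω.2, sub_eq_zero.1 h0⟩

theorem isGreatest_tan_inv {ω : ℝ} (h0 : 0 < ω) (h1 : ω < Real.pi / 2)
    (h : ω * Real.sin ω = Real.cos ω) :
    IsGreatest {x : ℝ | x ≠ 0 ∧ Real.tan (1 / x) = x} (1 / ω) := by
  have hcos : 0 < Real.cos ω := Real.cos_pos_of_mem_Ioo ⟨by linarith, h1⟩
  have htan : Real.tan ω = 1 / ω := by
    rw [Real.tan_eq_sin_div_cos, div_eq_div_iff hcos.ne' h0.ne']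
    linarith
  refine ⟨⟨by positivity, by rwa [one_div_one_div]⟩, ?_⟩
  rintro x ⟨-, hx⟩
  by_contra! hlt
  have hx0 : 0 < x := lt_trans (by positivity) hlt
  have hxω : 1 / x < ω := (one_div_lt hx0 h0).2 hlt
  have hm := Real.tan_lt_tan_of_lt_of_lt_pi_div_two
    (by have : 0 < 1 / x := by positivity
        linarith [Real.pi_pos]) h1 hxω
  rw [hx, htan] at hm
  exact lt_asymm hlt hm

theorem abs_inv_sq_sub_lt {ω : ℝ} (h1 : 0.8603334 < ω) (h2 : ω < 0.8603360) :
    |(1 / ω) ^ 2 - 1.35103| < 0.000005 := by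
  have h0 : 0 < ω := by linarith
  have h3 : 0.8603334 ^ 2 < ω ^ 2 := by gcongr
  have h4 : ω ^ 2 < 0.8603360 ^ 2 := by gcongr
  rw [one_div, inv_pow, abs_lt]
  constructor
  · rw [neg_lt_sub_iff_lt_add, ← sub_lt_iff_lt_add', lt_inv_comm₀ (by norm_num) (by positivity)]
    exact h4.trans (by norm_num)
  · rw [sub_lt_iff_lt_add, inv_lt_comm₀ (by positivity) (by norm_num)]
    exact lt_trans (by norm_num) h3

/-! ### A discrete integral operator and its subeigenfunction -/

theorem sum_Icc_sub_telescope (g : ℤ → ℝ) {a b : ℤ} (hab : a ≤ b) :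
    ∑ x ∈ Finset.Icc a b, (g (x + 1) - g x) = g (b + 1) - g a := by
  induction b, hab using Int.leInduction with
  | base => simp
  | succ b hb ih =>
    have : Finset.Icc a (b + 1) = insert (b + 1) (Finset.Icc a b) := by
      ext x
      simp only [Finset.mem_Icc, Finset.mem_insert]
      omega
    rw [this, Finset.sum_insert (by simp), ih]
    ring

theorem sum_Icc_neg (g : ℤ → ℝ) (h : ℤ) :
    ∑ x ∈ Finset.Icc (-h) h, g (-x) = ∑ x ∈ Finset.Icc (-h) h, g x := by
  refine Finset.sum_bij (fun x _ => -x) ?_ ?_ ?_ ?_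
  · intro a ha
    simp only [Finset.mem_Icc] at ha ⊢
    omega
  · intro a _ b _ hab
    simpa using hab
  · intro b hb
    simp only [Finset.mem_Icc] at hb
    exact ⟨-b, by simp only [Finset.mem_Icc]; omega, by simp⟩
  · simp

/-- An even function on `ℤ` whose second difference vanishes on `(-h, h)` is constant on
`[-h, h]`. -/
theorem eq_of_even_of_second_diff {M : ℤ → ℝ} {h : ℤ} (heven : ∀ y, M (-y) = M y)
    (hM : ∀ y, |y| < h → M (y + 1) + M (y - 1) = 2 * M y) {y : ℤ} (hy : |y| ≤ h) :
    M y = M h := by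
  have key : ∀ k : ℕ, (k : ℤ) ≤ h → M k = M 0 ∧ ((k : ℤ) + 1 ≤ h → M (k + 1) = M 0) := by
    intro k
    induction k with
    | zero =>
      intro _
      refine ⟨by simp, fun hk => ?_⟩
      have h1 := hM 0 (by simp at hk ⊢; omega)
      have h2 := heven 1
      simp only [zero_add, zero_sub] at h1
      simp only [Nat.cast_zero, zero_add]
      linarith
    | succ k ih =>
      intro hk
      push_cast at hk ⊢
      obtain ⟨h1, h2⟩ := ih (by omega)
      refine ⟨h2 hk, fun hk' => ?_⟩
      have h3 := hM (k + 1) (by rw [abs_lt]; omega)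
      rw [add_sub_cancel_right, h1, h2 hk] at h3
      linarith
  have hnat : ∀ z : ℤ, 0 ≤ z → z ≤ h → M z = M 0 := by
    intro z hz hzh
    have := (key z.toNat (by omega)).1
    rwa [Int.toNat_of_nonneg hz] at this
  have habs : M y = M |y| := by
    rcases abs_choice y with h1 | h1 <;> rw [h1]
    exact (heven y).symm
  rw [habs, hnat _ (abs_nonneg y) hy, hnat h (by linarith [abs_nonneg y]) le_rfl]

/-- The operator with kernel `2h + 1 - |x - y|` on `[-h, h]`, which is the number of integers at
distance at most `h` from both `x` and `y` when `|x - y| ≤ 2h`. -/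
noncomputable def overlapOp (h : ℤ) (F : ℤ → ℝ) (y : ℤ) : ℝ :=
  ∑ x ∈ Finset.Icc (-h) h, F x * (2 * h + 1 - |x - y| : ℤ)

/-- `overlapOp` inverts the second difference operator up to the factor `-2`. -/
theorem overlapOp_second_diff (F : ℤ → ℝ) {h y : ℤ} (hy : |y| < h) :
    overlapOp h F (y + 1) + overlapOp h F (y - 1) = 2 * overlapOp h F y - 2 * F y := by
  have hmem : y ∈ Finset.Icc (-h) h := by
    rw [abs_lt] at hy
    rw [Finset.mem_Icc]
    omega
  have h2 : 2 * F y = ∑ x ∈ Finset.Icc (-h) h, if x = y then 2 * F x else 0 := by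
    rw [Finset.sum_ite_eq' (Finset.Icc (-h) h) y, if_pos hmem]
  rw [h2]
  unfold overlapOp
  rw [← Finset.sum_add_distrib, Finset.mul_sum, ← Finset.sum_sub_distrib]
  refine Finset.sum_congr rfl fun x _ => ?_
  have hint : |x - (y + 1)| + |x - (y - 1)| = 2 * |x - y| + if x = y then 2 else 0 := by
    split_ifs with hxy
    · subst hxy
      simp
    · grind
  have hreal : ((|x - (y + 1)| : ℤ) : ℝ) + ((|x - (y - 1)| : ℤ) : ℝ)
      = 2 * ((|x - y| : ℤ) : ℝ) + if x = y then 2 else 0 := by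
    split_ifs at hint ⊢ <;> exact_mod_cast hint
  split_ifs at hreal ⊢ <;> push_cast at hreal ⊢ <;> linear_combination (-F x) * hreal

theorem overlapOp_even {F : ℤ → ℝ} (hF : ∀ x, F (-x) = F x) (h y : ℤ) :
    overlapOp h F (-y) = overlapOp h F y := by
  unfold overlapOp
  rw [← sum_Icc_neg]
  refine Finset.sum_congr rfl fun x _ => ?_
  rw [hF, show -x - -y = -(x - y) by ring, abs_neg]

/-- At the endpoint the kernel is affine in `x`, and its odd part does not contribute. -/
theorem overlapOp_self {F : ℤ → ℝ} (hF : ∀ x, F (-x) = F x) (h : ℤ) :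
    overlapOp h F h = (h + 1) * ∑ x ∈ Finset.Icc (-h) h, F x := by
  have hodd : ∑ x ∈ Finset.Icc (-h) h, (x : ℝ) * F x = 0 := by
    have := sum_Icc_neg (fun x => (x : ℝ) * F x) h
    simp only [hF, Int.cast_neg, neg_mul, Finset.sum_neg_distrib] at this
    linarith
  have : overlapOp h F h = ∑ x ∈ Finset.Icc (-h) h, ((h + 1) * F x + x * F x) := by
    refine Finset.sum_congr rfl fun x hx => ?_
    rw [Finset.mem_Icc] at hx
    rw [abs_of_nonpos (by omega)]
    push_cast
    ring
  rw [this, Finset.sum_add_distrib, hodd, Finset.mul_sum, add_zero]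

theorem sum_cos_mul_sin (h : ℕ) (t : ℝ) :
    (∑ x ∈ Finset.Icc (-(h : ℤ)) h, Real.cos (2 * t * x)) * Real.sin t
      = Real.sin ((2 * h + 1) * t) := by
  have := sum_Icc_sub_telescope (fun x => Real.sin ((2 * x - 1) * t)) (a := -(h : ℤ)) (b := h)
    (by omega)
  have h2 : ∀ x : ℤ, Real.sin ((2 * ((x + 1 : ℤ) : ℝ) - 1) * t) - Real.sin ((2 * (x : ℝ) - 1) * t)
      = 2 * (Real.cos (2 * t * x) * Real.sin t) := by
    intro x
    have e1 : (2 * ((x + 1 : ℤ) : ℝ) - 1) * t = 2 * t * x + t := by push_cast; ring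
    have e2 : (2 * (x : ℝ) - 1) * t = 2 * t * x - t := by ring
    rw [e1, e2, Real.sin_add, Real.sin_sub]
    ring
  simp only [h2] at this
  rw [← Finset.mul_sum, ← Finset.sum_mul] at this
  have e3 : (2 * ((-(h : ℤ) : ℤ) : ℝ) - 1) * t = -((2 * h + 1) * t) := by push_cast; ring
  have e4 : (2 * (((h : ℤ) + 1 : ℤ) : ℝ) - 1) * t = (2 * h + 1) * t := by push_cast; ring
  rw [e3, e4, Real.sin_neg] at this
  linarith

/-- The function `cos (ω x / (h + 1/2))` is a subeigenfunction of `overlapOp h`, with eigenvalue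
bound `2 h² / ω²`.  The equation satisfied by `ω` is the boundary condition at `x = ± h`. -/
theorem overlapOp_cos_ge {ω : ℝ} (h0 : 0 < ω) (h1 : ω < Real.pi / 2)
    (hω : ω * Real.sin ω = Real.cos ω) (h : ℕ) {y : ℤ} (hy : |y| ≤ h) :
    2 * (1 / ω) ^ 2 * h ^ 2 * Real.cos (2 * (ω / (2 * h + 1)) * y)
      ≤ overlapOp h (fun x => Real.cos (2 * (ω / (2 * h + 1)) * x)) y := by
  set t := ω / (2 * h + 1) with ht
  set F : ℤ → ℝ := fun x => Real.cos (2 * t * x) with hF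
  have hpos : (0 : ℝ) < 2 * h + 1 := by positivity
  have ht0 : 0 < t := by positivity
  have htω : (2 * h + 1) * t = ω := by rw [ht]; field_simp
  have htle : t ≤ ω := div_le_self h0.le (by linarith [Nat.cast_nonneg (α := ℝ) h])
  have hsin : 0 < Real.sin t := Real.sin_pos_of_pos_of_lt_pi ht0 (by linarith [Real.pi_pos])
  have hcos : 0 < Real.cos t := Real.cos_pos_of_mem_Ioo ⟨by linarith, by linarith⟩
  have hcosω : 0 < Real.cos ω := Real.cos_pos_of_mem_Ioo ⟨by linarith, by linarith⟩
  have hsinω : 0 < Real.sin ω := Real.sin_pos_of_pos_of_lt_pi h0 (by linarith [Real.pi_pos])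
  have hFeven : ∀ x, F (-x) = F x := by
    intro x
    simp only [hF, Int.cast_neg, mul_neg, Real.cos_neg]
  -- `F` is an eigenfunction of the second difference, so `2 sin² t * overlapOp h F - F` has
  -- vanishing second difference.
  have hconst : ∀ {y : ℤ}, |y| ≤ h →
      2 * Real.sin t ^ 2 * overlapOp h F y - F y
        = 2 * Real.sin t ^ 2 * overlapOp h F h - F h := by
    intro y hy
    refine eq_of_even_of_second_diff (M := fun y => 2 * Real.sin t ^ 2 * overlapOp h F y - F y)
      (fun y => by simp only [overlapOp_even hFeven, hFeven]) ?_ hy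
    intro y hy
    have e := overlapOp_second_diff F hy
    have e2 : F (y + 1) + F (y - 1) = 2 * F y - 4 * Real.sin t ^ 2 * F y := by
      simp only [hF]
      have e1 : 2 * t * ((y + 1 : ℤ) : ℝ) = 2 * t * y + 2 * t := by push_cast; ring
      have e2 : 2 * t * ((y - 1 : ℤ) : ℝ) = 2 * t * y - 2 * t := by push_cast; ring
      rw [e1, e2, Real.cos_add, Real.cos_sub, Real.cos_two_mul, Real.cos_sq']
      ring
    linear_combination (2 * Real.sin t ^ 2) * e - e2
  -- At the endpoint the inequality reduces to `t * cos t ≤ sin t`, because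
  -- `cos ω = (2h + 1) * t * sin ω`.
  have hbdry : 0 ≤ 2 * Real.sin t ^ 2 * overlapOp h F h - F h := by
    rw [overlapOp_self hFeven]
    have hs := sum_cos_mul_sin h t
    rw [htω] at hs
    have hFh : F h = Real.cos ω * Real.cos t + Real.sin ω * Real.sin t := by
      rw [← Real.cos_sub, ← htω]
      simp only [hF]
      push_cast
      ring_nf
    have htan : t * Real.cos t ≤ Real.sin t := by
      have := Real.le_tan ht0.le (by linarith)
      rwa [Real.tan_eq_sin_div_cos, le_div_iff₀ hcos] at this
    have hw : Real.cos ω = (2 * h + 1) * t * Real.sin ω := by rw [htω, hω]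
    have e : 2 * Real.sin t ^ 2 * (((h : ℤ) + 1 : ℝ) * ∑ x ∈ Finset.Icc (-(h : ℤ)) h, F x)
        = 2 * (h + 1) * Real.sin t * Real.sin ω := by
      rw [← hs]
      push_cast
      ring
    rw [e, hFh, hw]
    have : 0 ≤ (2 * h + 1) * Real.sin ω * (Real.sin t - t * Real.cos t) := by
      have := sub_nonneg.2 htan
      positivity
    linarith
  have hFy : 0 ≤ F y := by
    refine (Real.cos_pos_of_mem_Ioo ?_).le
    have hyr : |(y : ℝ)| ≤ h := by exact_mod_cast hy
    have : |2 * t * y| ≤ ω := by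
      rw [abs_mul, abs_of_pos (by positivity : 0 < 2 * t)]
      nlinarith
    rw [abs_le] at this
    constructor <;> linarith
  have hmain : F y ≤ 2 * Real.sin t ^ 2 * overlapOp h F y := by
    have := hconst hy
    linarith
  have hsin2 : 2 * Real.sin t ^ 2 * (2 * (1 / ω) ^ 2 * h ^ 2) ≤ 1 := by
    have e : Real.sin t ^ 2 ≤ t ^ 2 := Real.sin_sq_le_sq
    have e2 : 2 * t * h * (1 / ω) ≤ 1 := by
      rw [mul_one_div, div_le_one h0]
      linarith
    have e3 : (2 * t * h * (1 / ω)) ^ 2 ≤ 1 := pow_le_one₀ (by positivity) e2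
    calc 2 * Real.sin t ^ 2 * (2 * (1 / ω) ^ 2 * h ^ 2)
        ≤ 2 * t ^ 2 * (2 * (1 / ω) ^ 2 * h ^ 2) := by gcongr
      _ = (2 * t * h * (1 / ω)) ^ 2 := by ring
      _ ≤ 1 := e3
  have hsp : 0 < 2 * Real.sin t ^ 2 := by positivity
  refine le_of_mul_le_mul_left ?_ hsp
  calc 2 * Real.sin t ^ 2 * (2 * (1 / ω) ^ 2 * h ^ 2 * F y)
      = 2 * Real.sin t ^ 2 * (2 * (1 / ω) ^ 2 * h ^ 2) * F y := by ring
    _ ≤ 1 * F y := by gcongr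
    _ ≤ _ := by rw [one_mul]; exact hmain

/-! ### Existence of the limit defining `c(G)` -/

/-- Extension of a function by the value `0` at the root `v`. -/
noncomputable def extendZero {V : Type*} (v : V) (g : {x : V // x ≠ v} → ℝ) (x : V) : ℝ :=
  open Classical in if hx : x ≠ v then g ⟨x, hx⟩ else 0

/-- The polytope of real `1`-Lipschitz functions on `G` vanishing at `v`, in the coordinates given
by the other vertices. -/
def lipPolytope {V : Type*} (G : SimpleGraph V) (v : V) : Set ({x : V // x ≠ v} → ℝ) :=
  {g | ∀ x y, G.Adj x y → |extendZero v g x - extendZero v g y| ≤ 1}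

theorem continuous_extendZero {V : Type*} (v x : V) : Continuous fun g => extendZero v g x := by
  unfold extendZero
  split_ifs
  · exact continuous_apply _
  · exact continuous_const

theorem isClosed_lipPolytope {V : Type*} (G : SimpleGraph V) (v : V) :
    IsClosed (lipPolytope G v) := by
  simp only [lipPolytope, Set.ofPred_forall]
  refine isClosed_iInter fun x => isClosed_iInter fun y => isClosed_iInter fun _ => ?_
  exact isClosed_le ((continuous_extendZero v x).sub (continuous_extendZero v y)).abs
    continuous_const

theorem convex_lipPolytope {V : Type*} (G : SimpleGraph V) (v : V) :
    Convex ℝ (lipPolytope G v) := by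
  intro f hf g hg a b ha hb hab x y hxy
  have hlin : ∀ z, extendZero v (a • f + b • g) z = a * extendZero v f z + b * extendZero v g z := by
    intro z
    unfold extendZero
    split_ifs <;> simp
  have h1 := abs_le.1 (hf x y hxy)
  have h2 := abs_le.1 (hg x y hxy)
  rw [hlin, hlin, abs_le]
  constructor <;> nlinarith

theorem isBounded_lipPolytope {V : Type*} [Fintype V] {G : SimpleGraph V} (hG : G.Connected)
    (v : V) : Bornology.IsBounded (lipPolytope G v) := by
  rw [← Bornology.forall_isBounded_image_eval_iff]
  intro i
  obtain ⟨p⟩ := hG.preconnected i.1 v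
  refine (Metric.isBounded_Icc (-(p.length : ℝ)) p.length).subset ?_
  rintro _ ⟨g, hg, rfl⟩
  have key : ∀ {u w : V} (q : G.Walk u w), |extendZero v g u - extendZero v g w| ≤ q.length := by
    intro u w q
    induction q with
    | nil => simp
    | @cons a b c hab q ih =>
      have h1 := hg a b hab
      have h2 := abs_sub_le (extendZero v g a) (extendZero v g b) (extendZero v g c)
      rw [SimpleGraph.Walk.length_cons]
      push_cast
      linarith
  have h1 := key p
  rw [show extendZero v g v = 0 by simp [extendZero],
    show extendZero v g i.1 = g i by simp [extendZero, i.2], sub_zero, abs_le] at h1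
  exact h1

open scoped Pointwise in
theorem mem_inv_smul_lattice_iff {ι : Type*} [Finite ι] {h : ℕ} [NeZero h] {g : ι → ℝ} :
    g ∈ (h : ℝ)⁻¹ • (Submodule.span ℤ (Set.range (Pi.basisFun ℝ ι)) : Set (ι → ℝ)) ↔
      ∀ i, ∃ k : ℤ, (k : ℝ) = h * g i := by
  rw [← Submodule.coe_pointwise_smul, SetLike.mem_coe, BoxIntegral.unitPartition.mem_smul_span_iff]
  simp

open scoped Pointwise in
theorem card_lipPolytope_inter {V : Type*} [Fintype V] {G : SimpleGraph V} (v : V) {h : ℕ}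
    (hh : h ≠ 0) :
    Nat.card ↑(lipPolytope G v ∩
      (h : ℝ)⁻¹ • (Submodule.span ℤ (Set.range (Pi.basisFun ℝ {x : V // x ≠ v})) :
        Set ({x : V // x ≠ v} → ℝ))) = (lipFunctions G {v} h).ncard := by
  have : NeZero h := ⟨hh⟩
  have hpos : (0 : ℝ) < h := by positivity
  rw [Nat.card_coe_set_eq]
  symm
  refine Set.ncard_congr (fun f _ i => (f i.1 : ℝ) / h) ?_ ?_ ?_
  · rintro f ⟨hf0, hf⟩
    have hext : ∀ z, extendZero v (fun i => (f i.1 : ℝ) / h) z = (f z : ℝ) / h := by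
      intro z
      by_cases hz : z = v
      · subst hz
        simp [extendZero, hf0 z rfl]
      · simp [extendZero, hz]
    refine ⟨fun x y hxy => ?_, ?_⟩
    · rw [hext, hext, ← sub_div, abs_div, abs_of_pos hpos, div_le_one hpos]
      exact_mod_cast hf x y hxy
    · rw [mem_inv_smul_lattice_iff]
      exact fun i => ⟨f i.1, by field_simp⟩
  · rintro f g ⟨hf, -⟩ ⟨hg, -⟩ hfg
    funext z
    by_cases hz : z = v
    · rw [hf z hz, hg z hz]
    · have := congrFun hfg ⟨z, hz⟩
      simp only [div_left_inj' hpos.ne'] at this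
      exact_mod_cast this
  · rintro g ⟨hg, hL⟩
    rw [mem_inv_smul_lattice_iff] at hL
    choose f hf using hL
    have hext : ∀ z, h * extendZero v g z =
        ((open Classical in if hz : z ≠ v then f ⟨z, hz⟩ else 0 : ℤ) : ℝ) := by
      intro z
      by_cases hz : z = v
      · simp [extendZero, hz]
      · simpa [extendZero, hz] using (hf ⟨z, hz⟩).symm
    refine ⟨fun z => open Classical in if hz : z ≠ v then f ⟨z, hz⟩ else 0, ⟨?_, ?_⟩, ?_⟩
    · rintro x rfl
      simp
    · intro x y hxy
      have := hg x y hxy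
      have h2 : |(h : ℝ) * extendZero v g x - h * extendZero v g y| ≤ h := by
        rw [← mul_sub, abs_mul, abs_of_pos hpos]
        exact mul_le_of_le_one_right hpos.le this
      rw [hext, hext] at h2
      exact_mod_cast h2
    · funext i
      have := hf i
      simp only [i.2, ne_eq, not_false_eq_true, dite_true]
      rw [div_eq_iff hpos.ne', mul_comm]
      simpa using this

theorem exists_tendsto_lipCount_div {V : Type*} [Fintype V] {G : SimpleGraph V}
    (hG : G.Connected) :
    ∃ a : ℝ, Tendsto (fun h : ℕ => (lipCount G h : ℝ) / (h : ℝ) ^ (Fintype.card V - 1)) atTop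
      (𝓝 a) := by
  classical
  obtain ⟨v⟩ := hG.nonempty
  refine ⟨MeasureTheory.volume.real (lipPolytope G v), ?_⟩
  have h1 := tendsto_card_div_pow_atTop_volume (lipPolytope G v) (isBounded_lipPolytope hG v)
    (isClosed_lipPolytope G v).measurableSet ((convex_lipPolytope G v).addHaar_frontier _)
  refine h1.congr' ?_
  filter_upwards [eventually_ne_atTop 0] with h hh
  rw [card_lipPolytope_inter v hh, lipCount_eq_of_connected hG v, Fintype.card_subtype_compl,
    Fintype.card_subtype_eq]

/-- The limit of `|Lip(G; h)| / h ^ (N - 1)`, where `N` is the number of vertices of `G`: the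
volume of the polytope of real `1`-Lipschitz functions.  Then `c(G)` is its `(N - 1)`-st root. -/
noncomputable def lipVolume {V : Type*} [Fintype V] (G : SimpleGraph V) : ℝ :=
  limUnder atTop fun h : ℕ => (lipCount G h : ℝ) / (h : ℝ) ^ (Fintype.card V - 1)

theorem tendsto_lipVolume {V : Type*} [Fintype V] {G : SimpleGraph V} (hG : G.Connected) :
    Tendsto (fun h : ℕ => (lipCount G h : ℝ) / (h : ℝ) ^ (Fintype.card V - 1)) atTop
      (𝓝 (lipVolume G)) :=
  tendsto_nhds_limUnder (exists_tendsto_lipCount_div hG)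

theorem tendsto_lipRate {V : Type*} [Fintype V] {G : SimpleGraph V} (hG : G.Connected)
    (hV : 2 ≤ Fintype.card V) :
    Tendsto (lipRate G) atTop (𝓝 (lipVolume G ^ (1 / ((Fintype.card V : ℝ) - 1)))) := by
  have hcomp : Nat.card G.ConnectedComponent = 1 := by
    have := hG.preconnected.subsingleton_connectedComponent
    have := hG.nonempty
    exact Nat.card_unique
  have hcast : ((Fintype.card V - 1 : ℕ) : ℝ) = (Fintype.card V : ℝ) - 1 := by
    rw [Nat.cast_sub (by omega), Nat.cast_one]
  have hpos : (0 : ℝ) < (Fintype.card V : ℝ) - 1 := by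
    have : (2 : ℝ) ≤ Fintype.card V := by exact_mod_cast hV
    linarith
  have h1 := (tendsto_lipVolume hG).rpow_const
    (p := 1 / ((Fintype.card V : ℝ) - 1)) (Or.inr (by positivity))
  refine h1.congr' ?_
  filter_upwards [eventually_ne_atTop 0] with h hh
  have hh0 : (0 : ℝ) ≤ h := by positivity
  rw [lipRate, hcomp, Nat.card_eq_fintype_card, Nat.cast_one, Real.div_rpow (by positivity)
    (by positivity), ← Real.rpow_natCast, hcast, ← Real.rpow_mul hh0, mul_one_div_cancel hpos.ne',
    Real.rpow_one, div_eq_mul_one_div, mul_comm]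

theorem lipConst_eq {V : Type*} [Fintype V] {G : SimpleGraph V} (hG : G.Connected)
    (hV : 2 ≤ Fintype.card V) :
    lipConst G = lipVolume G ^ (1 / ((Fintype.card V : ℝ) - 1)) :=
  (tendsto_lipRate hG hV).limUnder_eq

/-! ### Inequalities between the counts -/

theorem grid_connected (m n : ℕ) : (grid (m + 1) (n + 1)).Connected :=
  (SimpleGraph.pathGraph_connected m).boxProd (SimpleGraph.pathGraph_connected n)

theorem grid_adj_iff {m n : ℕ} {x y : Fin m × Fin n} :
    (grid m n).Adj x y ↔
      ((x.1.val + 1 = y.1.val ∨ y.1.val + 1 = x.1.val) ∧ x.2 = y.2) ∨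
      ((x.2.val + 1 = y.2.val ∨ y.2.val + 1 = x.2.val) ∧ x.1 = y.1) := by
  rw [grid, SimpleGraph.boxProd_adj, SimpleGraph.pathGraph_adj, SimpleGraph.pathGraph_adj]

theorem lip_grid_iff {m n h : ℕ} {f : Fin m × Fin n → ℤ} :
    (∀ x y, (grid m n).Adj x y → |f x - f y| ≤ (h : ℤ)) ↔
      (∀ i i' j, i.val + 1 = i'.val → |f (i, j) - f (i', j)| ≤ (h : ℤ)) ∧
      (∀ i j j', j.val + 1 = j'.val → |f (i, j) - f (i, j')| ≤ (h : ℤ)) := by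
  constructor
  · intro hf
    exact ⟨fun i i' j hi => hf _ _ (grid_adj_iff.2 (Or.inl ⟨Or.inl hi, rfl⟩)),
      fun i j j' hj => hf _ _ (grid_adj_iff.2 (Or.inr ⟨Or.inl hj, rfl⟩))⟩
  · rintro ⟨h1, h2⟩ ⟨i, j⟩ ⟨i', j'⟩ hadj
    rcases grid_adj_iff.1 hadj with ⟨hi | hi, hj⟩ | ⟨hj | hj, hi⟩ <;> simp only at hi hj
    · subst hj
      exact h1 _ _ _ hi
    · subst hj
      rw [abs_sub_comm]
      exact h1 _ _ _ hi
    · subst hi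
      exact h2 _ _ _ hj
    · subst hi
      rw [abs_sub_comm]
      exact h2 _ _ _ hj

theorem finite_lipFunctions {V : Type*} [Finite V] {G : SimpleGraph V} (hG : G.Connected) (v : V)
    (h : ℕ) : (lipFunctions G {v} h).Finite := by
  have key : ∀ w : V, ∃ N : ℤ, ∀ f ∈ lipFunctions G {v} h, |f w| ≤ N := by
    intro w
    obtain ⟨p⟩ := hG.preconnected w v
    refine ⟨(p.length : ℤ) * h, fun f hf => ?_⟩
    have h1 := abs_sub_le_of_walk hf.2 p
    rwa [hf.1 v rfl, sub_zero] at h1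
  choose N hN using key
  refine (Set.Finite.pi' (fun w => Set.finite_Icc (-N w) (N w))).subset ?_
  intro f hf w
  exact abs_le.mp (hN w f hf)

/-- If two connected graphs map to `G` so that their images cover the vertices, then a function
on `G` is determined by its normalized restrictions and by its increment along an edge between
the images. -/
theorem lipCount_le_mul {V V₁ V₂ : Type*} [Finite V₁] [Finite V₂] {G : SimpleGraph V}
    {G₁ : SimpleGraph V₁} {G₂ : SimpleGraph V₂} (hG : G.Connected) (hG₁ : G₁.Connected)
    (hG₂ : G₂.Connected) (φ₁ : G₁ →g G) (φ₂ : G₂ →g G)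
    (hcover : ∀ v, (∃ a, φ₁ a = v) ∨ ∃ b, φ₂ b = v) {a : V₁} {b : V₂} (hab : G.Adj (φ₁ a) (φ₂ b))
    (h : ℕ) : lipCount G h ≤ lipCount G₁ h * lipCount G₂ h * (2 * h + 1) := by
  rw [lipCount_eq_of_connected hG (φ₁ a), lipCount_eq_of_connected hG₁ a,
    lipCount_eq_of_connected hG₂ b]
  have hI : (Set.Icc (-(h : ℤ)) h).ncard = 2 * h + 1 := by
    rw [Set.ncard_eq_toFinset_card', Set.toFinset_Icc, Int.card_Icc]
    omega
  rw [← hI, ← Set.ncard_prod, ← Set.ncard_prod]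
  refine Set.ncard_le_ncard_of_injOn
    (fun f => ((fun x => f (φ₁ x), fun x => f (φ₂ x) - f (φ₂ b)), f (φ₂ b))) ?_ ?_
    (((finite_lipFunctions hG₁ a h).prod (finite_lipFunctions hG₂ b h)).prod (Set.finite_Icc _ _))
  · rintro f ⟨hf0, hf⟩
    have h0 : f (φ₁ a) = 0 := hf0 _ rfl
    refine ⟨⟨⟨?_, ?_⟩, ⟨?_, ?_⟩⟩, ?_⟩
    · rintro x rfl
      exact h0
    · intro x y hxy
      exact hf _ _ (φ₁.map_adj hxy)
    · rintro x rfl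
      exact sub_self _
    · intro x y hxy
      simpa using hf _ _ (φ₂.map_adj hxy)
    · have := hf _ _ hab
      rw [h0, zero_sub, abs_neg, abs_le] at this
      exact this
  · intro f _ g _ hfg
    simp only [Prod.mk.injEq] at hfg
    obtain ⟨⟨h1, h2⟩, h3⟩ := hfg
    funext v
    rcases hcover v with ⟨x, rfl⟩ | ⟨x, rfl⟩
    · exact congrFun h1 x
    · have := congrFun h2 x
      linarith

theorem lipCount_grid_add_left (m₁ m₂ n h : ℕ) :
    lipCount (grid (m₁ + 1 + (m₂ + 1)) (n + 1)) h ≤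
      lipCount (grid (m₁ + 1) (n + 1)) h * lipCount (grid (m₂ + 1) (n + 1)) h * (2 * h + 1) := by
  have hG : (grid (m₁ + 1 + (m₂ + 1)) (n + 1)).Connected := grid_connected (m₁ + 1 + m₂) n
  refine lipCount_le_mul hG (grid_connected _ _) (grid_connected _ _)
    ⟨fun p => (Fin.castAdd _ p.1, p.2), ?_⟩ ⟨fun p => (Fin.natAdd _ p.1, p.2), ?_⟩ ?_
    (a := (Fin.last _, 0)) (b := (0, 0)) ?_ h
  · intro x y hxy
    rw [grid_adj_iff] at hxy ⊢
    simpa [Fin.ext_iff] using hxy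
  · intro x y hxy
    rw [grid_adj_iff] at hxy ⊢
    simpa [Fin.ext_iff, add_assoc] using hxy
  · rintro ⟨i, j⟩
    refine Fin.addCases (fun i => Or.inl ⟨(i, j), rfl⟩) (fun i => Or.inr ⟨(i, j), rfl⟩) i
  · rw [grid_adj_iff]
    simp

theorem lipCount_grid_add_right (m n₁ n₂ h : ℕ) :
    lipCount (grid (m + 1) (n₁ + 1 + (n₂ + 1))) h ≤
      lipCount (grid (m + 1) (n₁ + 1)) h * lipCount (grid (m + 1) (n₂ + 1)) h * (2 * h + 1) := by
  have hG : (grid (m + 1) (n₁ + 1 + (n₂ + 1))).Connected := grid_connected m (n₁ + 1 + n₂)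
  refine lipCount_le_mul hG (grid_connected _ _) (grid_connected _ _)
    ⟨fun p => (p.1, Fin.castAdd _ p.2), ?_⟩ ⟨fun p => (p.1, Fin.natAdd _ p.2), ?_⟩ ?_
    (a := (0, Fin.last _)) (b := (0, 0)) ?_ h
  · intro x y hxy
    rw [grid_adj_iff] at hxy ⊢
    simpa [Fin.ext_iff] using hxy
  · intro x y hxy
    rw [grid_adj_iff] at hxy ⊢
    simpa [Fin.ext_iff, add_assoc] using hxy
  · rintro ⟨i, j⟩
    refine Fin.addCases (fun j => Or.inl ⟨(i, j), rfl⟩) (fun j => Or.inr ⟨(i, j), rfl⟩) j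
  · rw [grid_adj_iff]
    simp

/-- Functions with values in `[0, h]` give a lower bound for the count. -/
theorem pow_le_lipCount {V : Type*} [Fintype V] {G : SimpleGraph V} (hG : G.Connected) (h : ℕ) :
    (h + 1) ^ (Fintype.card V - 1) ≤ lipCount G h := by
  classical
  obtain ⟨v⟩ := hG.nonempty
  have := (finite_lipFunctions hG v h).to_subtype
  rw [lipCount_eq_of_connected hG v, ← Nat.card_coe_set_eq]
  have hcard : Nat.card ({x : V // x ≠ v} → Fin (h + 1)) = (h + 1) ^ (Fintype.card V - 1) := by
    rw [Nat.card_eq_fintype_card, Fintype.card_fun, Fintype.card_fin, Fintype.card_subtype_compl,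
      Fintype.card_subtype_eq]
  rw [← hcard]
  let ext : ({x : V // x ≠ v} → Fin (h + 1)) → V → ℤ :=
    fun g x => if hx : x ≠ v then (g ⟨x, hx⟩ : ℕ) else 0
  have hext : ∀ g x, 0 ≤ ext g x ∧ ext g x ≤ h := by
    intro g x
    simp only [ext]
    split_ifs
    · omega
    · omega
  refine Nat.card_le_card_of_injective (fun g => ⟨ext g, ?_, ?_⟩) ?_
  · rintro x rfl
    simp [ext]
  · intro x y _
    have h1 := hext g x
    have h2 := hext g y
    rw [abs_le]
    omega
  · intro g g' hgg
    funext x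
    have := congrFun (Subtype.ext_iff.1 hgg) x.1
    simp only [ext, x.2, ne_eq, not_false_eq_true, dite_true] at this
    exact Fin.ext (by exact_mod_cast this)

/-- The function on `2j + 1` rows whose middle row is the common initial row of `f₁` and `f₂`, with
`f₁` running upwards from it and `f₂` downwards. -/
def reflectGlue {j n : ℕ} (f₁ f₂ : Fin (j + 1) × Fin n → ℤ) (p : Fin (2 * j + 1) × Fin n) : ℤ :=
  if hp : p.1.val ≤ j then f₁ (⟨j - p.1.val, by omega⟩, p.2)
  else f₂ (⟨p.1.val - j, by omega⟩, p.2)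

theorem reflectGlue_mem {j n h : ℕ} {f₁ f₂ : Fin (j + 1) × Fin (n + 1) → ℤ}
    (h₁ : f₁ ∈ lipFunctions (grid (j + 1) (n + 1)) {(0, 0)} h)
    (h₂ : f₂ ∈ lipFunctions (grid (j + 1) (n + 1)) {(0, 0)} h)
    (h12 : ∀ x, f₁ (0, x) = f₂ (0, x)) :
    reflectGlue f₁ f₂ ∈
      lipFunctions (grid (2 * j + 1) (n + 1)) {(⟨j, by omega⟩, 0)} h := by
  obtain ⟨r1, c1⟩ := lip_grid_iff.1 h₁.2
  obtain ⟨r2, c2⟩ := lip_grid_iff.1 h₂.2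
  refine ⟨?_, lip_grid_iff.2 ⟨?_, ?_⟩⟩
  · rintro x rfl
    simpa [reflectGlue] using h₁.1 _ rfl
  · intro i i' x hi
    unfold reflectGlue
    simp only
    split_ifs with ha hb hb
    · rw [abs_sub_comm]
      exact r1 _ _ _ (by simp only; omega)
    · have e1 : (⟨j - i.val, by omega⟩ : Fin (j + 1)) = 0 := Fin.ext (by simp; omega)
      rw [e1, h12]
      exact r2 _ _ _ (by simp only [Fin.val_zero]; omega)
    · omega
    · exact r2 _ _ _ (by simp only; omega)
  · intro i x x' hx
    unfold reflectGlue
    simp only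
    split_ifs
    · exact c1 _ _ _ hx
    · exact c2 _ _ _ hx

theorem reflectGlue_injective {j n : ℕ} {f₁ f₂ g₁ g₂ : Fin (j + 1) × Fin n → ℤ}
    (hf : ∀ x, f₁ (0, x) = f₂ (0, x)) (hg : ∀ x, g₁ (0, x) = g₂ (0, x))
    (h : reflectGlue f₁ f₂ = reflectGlue g₁ g₂) : f₁ = g₁ ∧ f₂ = g₂ := by
  have e1 : f₁ = g₁ := by
    funext ⟨i, x⟩
    have := congrFun h (⟨j - i.val, by omega⟩, x)
    simp only [reflectGlue, tsub_le_iff_right, le_add_iff_nonneg_right, zero_le, dite_true] at this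
    have hi : (⟨j - (j - i.val), by omega⟩ : Fin (j + 1)) = i := Fin.ext (by simp only; omega)
    rwa [hi] at this
  refine ⟨e1, ?_⟩
  funext ⟨i, x⟩
  by_cases hi0 : i = 0
  · rw [hi0, ← hf, ← hg, e1]
  · have hi1 : 0 < i.val := Nat.pos_of_ne_zero fun h0 => hi0 (Fin.ext h0)
    have := congrFun h (⟨j + i.val, by omega⟩, x)
    have hlt : ¬ (j + i.val ≤ j) := by omega
    simp only [reflectGlue, hlt, dite_false] at this
    have hi : (⟨j + i.val - j, by omega⟩ : Fin (j + 1)) = i := Fin.ext (by simp only; omega)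
    rwa [hi] at this

/-- Cauchy–Schwarz for the row-to-row transfer operator: pairs of functions on `j + 1` rows with
the same initial row glue to functions on `2j + 1` rows. -/
theorem lipCount_grid_sq_le (j n h : ℕ) :
    lipCount (grid (j + 1) (n + 1)) h ^ 2 ≤
      lipCount (grid 1 (n + 1)) h * lipCount (grid (2 * j + 1) (n + 1)) h := by
  classical
  rw [lipCount_eq_of_connected (grid_connected j n) (0, 0),
    lipCount_eq_of_connected (grid_connected 0 n) (0, 0),
    lipCount_eq_of_connected (grid_connected (2 * j) n) (⟨j, by omega⟩, 0)]
  have hS := finite_lipFunctions (grid_connected j n) (0, 0) h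
  have hT := finite_lipFunctions (grid_connected 0 n) (0, 0) h
  have hU := finite_lipFunctions (grid_connected (2 * j) n) (⟨j, by omega⟩, 0) h
  rw [Set.ncard_eq_toFinset_card _ hS, Set.ncard_eq_toFinset_card _ hT,
    Set.ncard_eq_toFinset_card _ hU]
  set S := hS.toFinset
  set T := hT.toFinset
  let row : (Fin (j + 1) × Fin (n + 1) → ℤ) → Fin 1 × Fin (n + 1) → ℤ := fun f p => f (0, p.2)
  have hrow : ∀ {f g}, row f = row g → ∀ x, f (0, x) = g (0, x) := fun hfg x =>
    congrFun hfg (0, x)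
  have hmap : ∀ f ∈ S, row f ∈ T := by
    intro f hf
    obtain ⟨hf0, hf⟩ := hS.mem_toFinset.1 hf
    refine hT.mem_toFinset.2 ⟨?_, lip_grid_iff.2 ⟨?_, ?_⟩⟩
    · rintro x rfl
      exact hf0 _ rfl
    · intro i i' x hi
      omega
    · intro i x x' hx
      exact (lip_grid_iff.1 hf).2 0 x x' hx
  let P := (S ×ˢ S).filter fun q => row q.1 = row q.2
  have hPmap : ∀ q ∈ P, row q.1 ∈ T := fun q hq =>
    hmap _ (Finset.mem_product.1 (Finset.mem_filter.1 hq).1).1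
  have hfib : ∀ g, (P.filter fun q => row q.1 = g).card = (S.filter fun f => row f = g).card ^ 2 := by
    intro g
    rw [sq, ← Finset.card_product]
    congr 1
    ext q
    simp only [P, Finset.mem_filter, Finset.mem_product]
    constructor
    · rintro ⟨⟨⟨h1, h2⟩, h3⟩, h4⟩
      exact ⟨⟨h1, h4⟩, h2, h3 ▸ h4⟩
    · rintro ⟨⟨h1, h4⟩, h2, h3⟩
      exact ⟨⟨⟨h1, h2⟩, h4.trans h3.symm⟩, h4⟩
  calc S.card ^ 2 = (∑ g ∈ T, (S.filter fun f => row f = g).card) ^ 2 := by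
        rw [← Finset.card_eq_sum_card_fiberwise hmap]
    _ ≤ T.card * ∑ g ∈ T, (S.filter fun f => row f = g).card ^ 2 := sq_sum_le_card_mul_sum_sq
    _ = T.card * P.card := by
        rw [Finset.card_eq_sum_card_fiberwise hPmap]
        simp only [hfib]
    _ ≤ T.card * hU.toFinset.card := by
        refine Nat.mul_le_mul_left _ (Finset.card_le_card_of_injOn
          (fun q => reflectGlue q.1 q.2) ?_ ?_)
        · intro q hq
          simp only [P, Finset.coe_filter, Finset.mem_product, Set.mem_ofPred_eq] at hq
          exact hU.mem_toFinset.2 (reflectGlue_mem (hS.mem_toFinset.1 hq.1.1)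
            (hS.mem_toFinset.1 hq.1.2) (hrow hq.2))
        · intro q hq q' hq' hqq
          simp only [P, Finset.coe_filter, Finset.mem_product, Set.mem_ofPred_eq] at hq hq'
          have := reflectGlue_injective (hrow hq.2) (hrow hq'.2) hqq
          exact Prod.ext this.1 this.2

/-! ### The ladder -/

/-- The `h`-Lipschitz functions on the ladder `L_{2,n+1}` which vanish at one end of the last
rung. -/
noncomputable def ladderFunctions (n h : ℕ) : Finset (Fin 2 × Fin (n + 1) → ℤ) :=
  (finite_lipFunctions (grid_connected 1 n) (0, Fin.last n) h).toFinset

theorem mem_ladderFunctions {n h : ℕ} {f : Fin 2 × Fin (n + 1) → ℤ} :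
    f ∈ ladderFunctions n h ↔ f (0, Fin.last n) = 0 ∧
      (∀ j, |f (0, j) - f (1, j)| ≤ (h : ℤ)) ∧
      (∀ i j j', j.val + 1 = j'.val → |f (i, j) - f (i, j')| ≤ (h : ℤ)) := by
  rw [ladderFunctions, Set.Finite.mem_toFinset, lipFunctions, Set.mem_ofPred_eq, lip_grid_iff]
  simp only [Set.mem_singleton_iff, forall_eq]
  refine and_congr_right fun _ => and_congr_left fun _ => ?_
  constructor
  · intro H j
    exact H 0 1 j rfl
  · intro H i i' j hi
    have h0 : i = 0 := Fin.ext (by simp only [Fin.val_zero]; omega)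
    have h1 : i' = 1 := Fin.ext (by simp only [Fin.val_one]; omega)
    subst h0 h1
    exact H j

/-- The sum over the functions on a ladder of the weight `F` of the increment along the initial
rung. -/
noncomputable def rungSum (n h : ℕ) (F : ℤ → ℝ) : ℝ :=
  ∑ f ∈ ladderFunctions n h, F (f (1, 0) - f (0, 0))

/-- Adding a rung with the values `u` and `v` in front of the ladder, which leaves the root at the
far end in place. -/
def addRung {n : ℕ} (f : Fin 2 × Fin (n + 1) → ℤ) (u v : ℤ) (p : Fin 2 × Fin (n + 2)) : ℤ :=
  Fin.cons (α := fun _ => ℤ) (if p.1 = 0 then u else v) (fun j => f (p.1, j)) p.2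

theorem addRung_mem {n h : ℕ} {f : Fin 2 × Fin (n + 1) → ℤ} (hf : f ∈ ladderFunctions n h)
    {u v : ℤ} (huv : |u - v| ≤ (h : ℤ)) (hu : |u - f (0, 0)| ≤ (h : ℤ))
    (hv : |v - f (1, 0)| ≤ (h : ℤ)) : addRung f u v ∈ ladderFunctions (n + 1) h := by
  rw [mem_ladderFunctions] at hf ⊢
  obtain ⟨h0, h1, h2⟩ := hf
  refine ⟨?_, ?_, ?_⟩
  · rw [← Fin.succ_last]
    simpa [addRung] using h0
  · intro j
    refine Fin.cases ?_ (fun j => ?_) j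
    · simpa [addRung] using huv
    · simpa [addRung] using h1 j
  · intro i j j'
    refine Fin.cases ?_ (fun j => ?_) j <;> refine Fin.cases ?_ (fun j' => ?_) j'
    · simp
    · intro hj
      have hj' : j' = 0 := Fin.ext (by simpa using hj.symm)
      subst hj'
      fin_cases i
      · simpa [addRung] using hu
      · simpa [addRung] using hv
    · simp
    · intro hj
      simpa [addRung] using h2 i j j' (by simpa using hj)

/-- A subeigenfunction of `overlapOp` gives the growth of the weighted sums: a rung with increment
`y` is followed by a rung with increment `x` in at least `2h + 1 - |x - y|` ways. -/
theorem rungSum_succ_ge {n h : ℕ} {F : ℤ → ℝ} (hF : ∀ x, |x| ≤ (h : ℤ) → 0 ≤ F x) {c : ℝ}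
    (hc : ∀ y, |y| ≤ (h : ℤ) → c * F y ≤ overlapOp h F y) :
    c * rungSum n h F ≤ rungSum (n + 1) h F := by
  classical
  -- For a new rung with values `u` and `u + x`, the Lipschitz condition along the two rails says
  -- `lo f x ≤ u ≤ hi f x`.
  let lo : (Fin 2 × Fin (n + 1) → ℤ) → ℤ → ℤ := fun f x => max (f (0, 0)) (f (1, 0) - x) - h
  let hi : (Fin 2 × Fin (n + 1) → ℤ) → ℤ → ℤ := fun f x => min (f (0, 0)) (f (1, 0) - x) + h
  let A : Finset ((_ : Fin 2 × Fin (n + 1) → ℤ) × ((_ : ℤ) × ℤ)) :=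
    (ladderFunctions n h).sigma fun f =>
      (Finset.Icc (-(h : ℤ)) h).sigma fun x => Finset.Icc (lo f x) (hi f x)
  let φ : ((_ : Fin 2 × Fin (n + 1) → ℤ) × ((_ : ℤ) × ℤ)) → Fin 2 × Fin (n + 2) → ℤ :=
    fun q => addRung q.1 q.2.2 (q.2.2 + q.2.1)
  have hφ : Set.InjOn φ A := by
    rintro ⟨f, x, u⟩ _ ⟨g, y, v⟩ _ hq
    have h1 := congrFun hq (0, 0)
    have h2 := congrFun hq (1, 0)
    have h3 : f = g := by
      funext ⟨i, j⟩
      simpa [φ, addRung] using congrFun hq (i, j.succ)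
    simp only [φ, addRung, Fin.cons_zero, if_true] at h1
    simp only [φ, addRung, Fin.cons_zero, Fin.one_eq_zero_iff, OfNat.ofNat_ne_one, if_false] at h2
    subst h3 h1
    have h4 : x = y := by linarith
    subst h4
    rfl
  have hφA : A.image φ ⊆ ladderFunctions (n + 1) h := by
    intro g hg
    obtain ⟨⟨f, x, u⟩, hq, rfl⟩ := Finset.mem_image.1 hg
    simp only [A, Finset.mem_sigma, Finset.mem_Icc, lo, hi] at hq
    obtain ⟨hf, hx, hu⟩ := hq
    exact addRung_mem hf (by grind) (by grind) (by grind)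
  calc c * rungSum n h F
      = ∑ f ∈ ladderFunctions n h, c * F (f (1, 0) - f (0, 0)) := by
        rw [rungSum, Finset.mul_sum]
    _ ≤ ∑ f ∈ ladderFunctions n h, ∑ x ∈ Finset.Icc (-(h : ℤ)) h,
          ∑ u ∈ Finset.Icc (lo f x) (hi f x), F x := by
        refine Finset.sum_le_sum fun f hf => ?_
        have hy : |f (1, 0) - f (0, 0)| ≤ (h : ℤ) := by
          rw [abs_sub_comm]
          exact (mem_ladderFunctions.1 hf).2.1 0
        refine (hc _ hy).trans (Finset.sum_le_sum fun x hx => ?_)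
        have hx' : |x| ≤ (h : ℤ) := abs_le.2 (Finset.mem_Icc.1 hx)
        rw [Finset.sum_const, nsmul_eq_mul, mul_comm, Int.card_Icc]
        refine mul_le_mul_of_nonneg_right ?_ (hF x hx')
        have : 2 * (h : ℤ) + 1 - |x - (f (1, 0) - f (0, 0))| ≤
            ((hi f x + 1 - lo f x).toNat : ℤ) := by
          refine le_trans ?_ (Int.self_le_toNat _)
          simp only [hi, lo]
          grind
        exact_mod_cast this
    _ = ∑ q ∈ A, F q.2.1 := by
        rw [Finset.sum_sigma]
        refine Finset.sum_congr rfl fun f _ => ?_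
        rw [Finset.sum_sigma]
    _ = ∑ g ∈ A.image φ, F (g (1, 0) - g (0, 0)) := by
        rw [Finset.sum_image hφ]
        refine Finset.sum_congr rfl fun q _ => ?_
        simp [φ, addRung]
    _ ≤ rungSum (n + 1) h F := by
        refine Finset.sum_le_sum_of_subset_of_nonneg hφA fun g hg _ => hF _ ?_
        rw [abs_sub_comm]
        exact (mem_ladderFunctions.1 hg).2.1 0

theorem rungSum_zero_ge {h : ℕ} {F : ℤ → ℝ} (hF : ∀ x, |x| ≤ (h : ℤ) → 1 / 2 ≤ F x) :
    (h : ℝ) ≤ rungSum 0 h F := by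
  classical
  let φ : ℤ → Fin 2 × Fin 1 → ℤ := fun x p => if p.1 = 0 then 0 else x
  have hφ : Function.Injective φ := by
    intro x y hxy
    simpa [φ] using congrFun hxy (1, 0)
  have hsub : (Finset.Icc (-(h : ℤ)) h).image φ ⊆ ladderFunctions 0 h := by
    intro g hg
    obtain ⟨x, hx, rfl⟩ := Finset.mem_image.1 hg
    rw [Finset.mem_Icc] at hx
    rw [mem_ladderFunctions]
    refine ⟨by simp [φ], ?_, ?_⟩
    · intro j
      simpa [φ, abs_le] using hx
    · intro i j j' hj
      omega
  calc (h : ℝ) ≤ ∑ x ∈ Finset.Icc (-(h : ℤ)) h, (1 / 2 : ℝ) := by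
        rw [Finset.sum_const, Int.card_Icc, nsmul_eq_mul,
          show ((h : ℤ) + 1 - -(h : ℤ)).toNat = 2 * h + 1 by omega]
        push_cast
        linarith
    _ ≤ ∑ x ∈ Finset.Icc (-(h : ℤ)) h, F x :=
        Finset.sum_le_sum fun x hx => hF x (abs_le.2 (Finset.mem_Icc.1 hx))
    _ = ∑ g ∈ (Finset.Icc (-(h : ℤ)) h).image φ, F (g (1, 0) - g (0, 0)) := by
        rw [Finset.sum_image hφ.injOn]
        refine Finset.sum_congr rfl fun x _ => ?_
        simp [φ]
    _ ≤ rungSum 0 h F := by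
        refine Finset.sum_le_sum_of_subset_of_nonneg hsub fun g hg _ => ?_
        refine le_trans (by norm_num) (hF _ ?_)
        rw [abs_sub_comm]
        exact (mem_ladderFunctions.1 hg).2.1 0

/-- The subeigenfunction `F` satisfies `1 / 2 ≤ F ≤ 1` on `[-h, h]`, since `ω ≤ π / 3`, so that
the weighted sums bound the unweighted count. -/
theorem lipCount_ladder_ge {ω : ℝ} (h0 : 0 < ω) (h1 : ω < 1)
    (hω : ω * Real.sin ω = Real.cos ω) (n h : ℕ) :
    (2 * (1 / ω) ^ 2 * (h : ℝ) ^ 2) ^ n * h ≤ lipCount (grid 2 (n + 1)) h := by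
  have hpi := Real.pi_gt_three
  set F : ℤ → ℝ := fun x => Real.cos (2 * (ω / (2 * h + 1)) * x) with hFdef
  have hF : ∀ x, |x| ≤ (h : ℤ) → 1 / 2 ≤ F x := by
    intro x hx
    have hxr : |(x : ℝ)| ≤ h := by exact_mod_cast hx
    have hle : |2 * (ω / (2 * h + 1)) * x| ≤ Real.pi / 3 := by
      rw [abs_mul, abs_of_pos (by positivity)]
      calc 2 * (ω / (2 * h + 1)) * |(x : ℝ)| ≤ 2 * (ω / (2 * h + 1)) * h := by gcongr
        _ = ω * (2 * h / (2 * h + 1)) := by ring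
        _ ≤ ω * 1 := by
            gcongr
            rw [div_le_one (by positivity)]
            linarith
        _ ≤ Real.pi / 3 := by linarith
    rw [← Real.cos_pi_div_three, hFdef]
    simp only
    rw [← Real.cos_abs (2 * (ω / (2 * h + 1)) * x)]
    exact Real.cos_le_cos_of_nonneg_of_le_pi (abs_nonneg _) (by linarith) hle
  have hstep : ∀ n, (2 * (1 / ω) ^ 2 * (h : ℝ) ^ 2) ^ n * h ≤ rungSum n h F := by
    intro n
    induction n with
    | zero => simpa using rungSum_zero_ge hF
    | succ n ih =>
      refine le_trans ?_ (rungSum_succ_ge (fun x hx => le_trans (by norm_num) (hF x hx))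
        (c := 2 * (1 / ω) ^ 2 * (h : ℝ) ^ 2)
        (fun y hy => overlapOp_cos_ge h0 (by linarith) hω h hy))
      rw [pow_succ', mul_assoc]
      gcongr
  refine (hstep n).trans ?_
  rw [lipCount_eq_of_connected (grid_connected 1 n) (0, Fin.last n),
    Set.ncard_eq_toFinset_card _ (finite_lipFunctions (grid_connected 1 n) (0, Fin.last n) h)]
  calc rungSum n h F ≤ ∑ f ∈ ladderFunctions n h, (1 : ℝ) :=
        Finset.sum_le_sum fun f _ => Real.cos_le_one _
    _ = _ := by
        rw [Finset.sum_const, nsmul_eq_mul, mul_one]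
        rfl

/-! ### Inequalities between the volumes -/

theorem tendsto_grid (m n : ℕ) :
    Tendsto (fun h : ℕ => (lipCount (grid (m + 1) (n + 1)) h : ℝ) /
      (h : ℝ) ^ ((m + 1) * (n + 1) - 1)) atTop (𝓝 (lipVolume (grid (m + 1) (n + 1)))) := by
  have := tendsto_lipVolume (grid_connected m n)
  rwa [Fintype.card_prod, Fintype.card_fin, Fintype.card_fin] at this

theorem tendsto_two_mul_add_one_div :
    Tendsto (fun h : ℕ => (2 * (h : ℝ) + 1) / h) atTop (𝓝 2) := by
  have h1 : Tendsto (fun h : ℕ => 2 + 1 / (h : ℝ)) atTop (𝓝 (2 + 0)) :=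
    tendsto_const_nhds.add tendsto_one_div_atTop_nhds_zero_nat
  rw [add_zero] at h1
  refine h1.congr' ?_
  filter_upwards [eventually_ne_atTop 0] with h hh
  have : (h : ℝ) ≠ 0 := by exact_mod_cast hh
  field_simp

theorem lipVolume_grid_add_left (m₁ m₂ n : ℕ) :
    lipVolume (grid (m₁ + 1 + (m₂ + 1)) (n + 1)) ≤
      lipVolume (grid (m₁ + 1) (n + 1)) * lipVolume (grid (m₂ + 1) (n + 1)) * 2 := by
  refine le_of_tendsto_of_tendsto' (tendsto_grid (m₁ + 1 + m₂) n)
    (((tendsto_grid m₁ n).mul (tendsto_grid m₂ n)).mul tendsto_two_mul_add_one_div) fun h => ?_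
  have hexp : (m₁ + 1 + m₂ + 1) * (n + 1) - 1 =
      ((m₁ + 1) * (n + 1) - 1) + ((m₂ + 1) * (n + 1) - 1) + 1 := by
    have h1 : 0 < (m₁ + 1) * (n + 1) := by positivity
    have h2 : 0 < (m₂ + 1) * (n + 1) := by positivity
    have h3 : (m₁ + 1 + m₂ + 1) * (n + 1) = (m₁ + 1) * (n + 1) + (m₂ + 1) * (n + 1) := by ring
    omega
  rw [hexp, pow_succ, pow_add, div_mul_div_comm, div_mul_div_comm]
  gcongr
  exact_mod_cast lipCount_grid_add_left m₁ m₂ n h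

theorem lipVolume_grid_add_right (m n₁ n₂ : ℕ) :
    lipVolume (grid (m + 1) (n₁ + 1 + (n₂ + 1))) ≤
      lipVolume (grid (m + 1) (n₁ + 1)) * lipVolume (grid (m + 1) (n₂ + 1)) * 2 := by
  refine le_of_tendsto_of_tendsto' (tendsto_grid m (n₁ + 1 + n₂))
    (((tendsto_grid m n₁).mul (tendsto_grid m n₂)).mul tendsto_two_mul_add_one_div) fun h => ?_
  have hexp : (m + 1) * (n₁ + 1 + n₂ + 1) - 1 =
      ((m + 1) * (n₁ + 1) - 1) + ((m + 1) * (n₂ + 1) - 1) + 1 := by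
    have h1 : 0 < (m + 1) * (n₁ + 1) := by positivity
    have h2 : 0 < (m + 1) * (n₂ + 1) := by positivity
    have h3 : (m + 1) * (n₁ + 1 + n₂ + 1) = (m + 1) * (n₁ + 1) + (m + 1) * (n₂ + 1) := by ring
    omega
  rw [hexp, pow_succ, pow_add, div_mul_div_comm, div_mul_div_comm]
  gcongr
  exact_mod_cast lipCount_grid_add_right m n₁ n₂ h

theorem one_le_lipVolume {V : Type*} [Fintype V] {G : SimpleGraph V} (hG : G.Connected) :
    1 ≤ lipVolume G := by
  refine ge_of_tendsto (tendsto_lipVolume hG) ?_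
  filter_upwards [eventually_gt_atTop 0] with h hh
  have hpos : (0 : ℝ) < h := by exact_mod_cast hh
  rw [one_le_div (by positivity)]
  calc (h : ℝ) ^ (Fintype.card V - 1) ≤ ((h : ℝ) + 1) ^ (Fintype.card V - 1) := by
        gcongr
        linarith
    _ ≤ _ := by exact_mod_cast pow_le_lipCount hG h

theorem lipVolume_grid_sq_le (j n : ℕ) :
    lipVolume (grid (j + 1) (n + 1)) ^ 2 ≤
      lipVolume (grid 1 (n + 1)) * lipVolume (grid (2 * j + 1) (n + 1)) := by
  refine le_of_tendsto_of_tendsto' ((tendsto_grid j n).pow 2)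
    ((tendsto_grid 0 n).mul (tendsto_grid (2 * j) n)) fun h => ?_
  have hexp : ((j + 1) * (n + 1) - 1) * 2 =
      ((0 + 1) * (n + 1) - 1) + ((2 * j + 1) * (n + 1) - 1) := by
    have h1 : 0 < (j + 1) * (n + 1) := by positivity
    have h2 : 0 < (2 * j + 1) * (n + 1) := by positivity
    have h3 : (j + 1) * (n + 1) * 2 = (0 + 1) * (n + 1) + (2 * j + 1) * (n + 1) := by ring
    omega
  rw [div_pow, ← pow_mul, hexp, pow_add, div_mul_div_comm]
  gcongr
  exact_mod_cast lipCount_grid_sq_le j n h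

theorem lipVolume_ladder_ge {ω : ℝ} (h0 : 0 < ω) (h1 : ω < 1)
    (hω : ω * Real.sin ω = Real.cos ω) (n : ℕ) :
    (2 * (1 / ω) ^ 2) ^ n ≤ lipVolume (grid 2 (n + 1)) := by
  refine ge_of_tendsto (tendsto_grid 1 n) ?_
  filter_upwards [eventually_gt_atTop 0] with h hh
  have hpos : (0 : ℝ) < h := by exact_mod_cast hh
  have hexp : (1 + 1) * (n + 1) - 1 = 2 * n + 1 := by omega
  rw [hexp, le_div_iff₀ (by positivity)]
  refine le_trans (le_of_eq ?_) (lipCount_ladder_ge h0 h1 hω n h)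
  rw [mul_pow _ ((h : ℝ) ^ 2), ← pow_mul, pow_succ]
  ring

theorem lipVolume_path_le (n : ℕ) : lipVolume (grid 1 (n + 1)) ≤ 2 ^ n := by
  have h1 : lipVolume (grid 1 1) ≤ 1 := by
    refine le_of_tendsto' (tendsto_grid 0 0) fun h => ?_
    have : lipCount (grid 1 1) h ≤ 1 := by
      rw [lipCount_eq_of_connected (grid_connected 0 0) (0, 0)]
      refine (Set.ncard_le_one (finite_lipFunctions (grid_connected 0 0) (0, 0) h)).2 ?_
      intro f hf g hg
      funext x
      rw [Subsingleton.elim (α := Fin 1 × Fin 1) x (0, 0), hf.1 _ rfl, hg.1 _ rfl]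
    simpa using this
  induction n with
  | zero => simpa using h1
  | succ n ih =>
    have h0 : 0 ≤ lipVolume (grid 1 (n + 1)) :=
      zero_le_one.trans (one_le_lipVolume (grid_connected 0 n))
    calc lipVolume (grid 1 (n + 1 + 1))
        ≤ lipVolume (grid 1 (n + 1)) * lipVolume (grid 1 1) * 2 :=
          lipVolume_grid_add_right 0 n 0
      _ ≤ 2 ^ n * 1 * 2 := by
          have h2 := mul_le_mul ih h1
            (zero_le_one.trans (one_le_lipVolume (grid_connected 0 0))) (by positivity)
          linarith
      _ = 2 ^ (n + 1) := by ring

/-- Repeated doubling of the number of rows, starting with the ladder. -/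
theorem lipVolume_grid_two_pow_ge {ω : ℝ} (h0 : 0 < ω) (h1 : ω < 1)
    (hω : ω * Real.sin ω = Real.cos ω) (n k : ℕ) :
    2 ^ n * ((1 / ω) ^ 2) ^ (n * 2 ^ k) ≤ lipVolume (grid (2 ^ k + 1) (n + 1)) := by
  induction k with
  | zero =>
    rw [pow_zero, mul_one, ← mul_pow]
    exact lipVolume_ladder_ge h0 h1 hω n
  | succ k ih =>
    have hV : 0 ≤ lipVolume (grid (2 * 2 ^ k + 1) (n + 1)) :=
      zero_le_one.trans (one_le_lipVolume (grid_connected _ n))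
    have hsq := (lipVolume_grid_sq_le (2 ^ k) n).trans
      (mul_le_mul_of_nonneg_right (lipVolume_path_le n) hV)
    rw [pow_succ' 2 k]
    refine le_of_mul_le_mul_left (le_trans (le_of_eq ?_)
      ((pow_le_pow_left₀ (by positivity) ih 2).trans hsq)) (by positivity : (0 : ℝ) < 2 ^ n)
    ring

/-! ### Subadditivity along the diagonal -/

/-- Fekete's lemma along the diagonal for a function which is subadditive in both variables. -/
theorem exists_tendsto_diag_of_subadditive {b : ℕ → ℕ → ℝ} (hb : ∀ m n, 0 ≤ b m n)
    (h0l : ∀ n, b 0 n = 0) (h0r : ∀ m, b m 0 = 0)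
    (hl : ∀ m₁ m₂ n, b (m₁ + m₂) n ≤ b m₁ n + b m₂ n)
    (hr : ∀ m n₁ n₂, b m (n₁ + n₂) ≤ b m n₁ + b m n₂) :
    ∃ L, Tendsto (fun n : ℕ => b n n / (n : ℝ) ^ 2) atTop (𝓝 L) := by
  have hlk : ∀ k m n, b (k * m) n ≤ k * b m n := by
    intro k m n
    induction k with
    | zero => simp [h0l]
    | succ k ih =>
      rw [Nat.succ_mul]
      push_cast
      linarith [hl (k * m) m n]
  have hrk : ∀ k m n, b m (k * n) ≤ k * b m n := by
    intro k m n
    induction k with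
    | zero => simp [h0r]
    | succ k ih =>
      rw [Nat.succ_mul]
      push_cast
      linarith [hr m (k * n) n]
  have hmn : ∀ m n : ℕ, b m n ≤ m * n * b 1 1 := by
    intro m n
    calc b m n = b (m * 1) n := by rw [mul_one]
      _ ≤ m * b 1 n := hlk m 1 n
      _ = m * b 1 (n * 1) := by rw [mul_one]
      _ ≤ m * (n * b 1 1) := by
          gcongr
          exact hrk n 1 1
      _ = m * n * b 1 1 := by ring
  -- Cut the `n × n` square into `(n / k)²` squares of side `k` and two strips of width below `k`.
  have hcut : ∀ k n : ℕ, 0 < k → 0 < n →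
      b n n / (n : ℝ) ^ 2 ≤ b k k / (k : ℝ) ^ 2 + 2 * k * b 1 1 * (1 / (n : ℝ)) := by
    intro k n hk hn
    have hkr : (0 : ℝ) < k := by exact_mod_cast hk
    have hnr : (0 : ℝ) < n := by exact_mod_cast hn
    set q := n / k with hq
    set r := n % k with hrdef
    have hn' : q * k + r = n := Nat.div_add_mod' n k
    have hrk' : (r : ℝ) ≤ k := by exact_mod_cast (Nat.mod_lt n hk).le
    have hqk : (q : ℝ) * k ≤ n := by exact_mod_cast (Nat.div_mul_le_self n k)
    have e1 : b n n ≤ b (q * k) n + b r n := by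
      have := hl (q * k) r n
      rwa [hn'] at this
    have e2 : b (q * k) n ≤ b (q * k) (q * k) + b (q * k) r := by
      have := hr (q * k) (q * k) r
      rwa [hn'] at this
    have e3 : b (q * k) (q * k) ≤ q * (q * b k k) :=
      (hlk q k (q * k)).trans (mul_le_mul_of_nonneg_left (hrk q k k) (Nat.cast_nonneg q))
    have e4 : b (q * k) r ≤ n * k * b 1 1 := by
      refine (hmn _ _).trans (mul_le_mul_of_nonneg_right ?_ (hb 1 1))
      push_cast
      gcongr
    have e5 : b r n ≤ n * k * b 1 1 := by
      refine (hmn _ _).trans (mul_le_mul_of_nonneg_right ?_ (hb 1 1))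
      rw [mul_comm (n : ℝ)]
      gcongr
    have e6 : (q : ℝ) * (q * b k k) ≤ b k k / (k : ℝ) ^ 2 * (n : ℝ) ^ 2 := by
      have hb0 : 0 ≤ b k k / (k : ℝ) ^ 2 := div_nonneg (hb k k) (by positivity)
      calc (q : ℝ) * (q * b k k) = b k k / (k : ℝ) ^ 2 * (q * k) ^ 2 := by
            field_simp
        _ ≤ _ := by gcongr
    rw [div_le_iff₀ (by positivity), add_mul]
    have e7 : 2 * k * b 1 1 * (1 / (n : ℝ)) * (n : ℝ) ^ 2 = 2 * (n * k * b 1 1) := by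
      field_simp
    rw [e7]
    linarith
  set S : Set ℝ := (fun k : ℕ => b k k / (k : ℝ) ^ 2) '' Set.Ici 1 with hS
  have hSne : S.Nonempty := ⟨_, 1, Set.mem_Ici.2 le_rfl, rfl⟩
  have hSb : BddBelow S := by
    refine ⟨0, ?_⟩
    rintro _ ⟨k, _, rfl⟩
    exact div_nonneg (hb k k) (by positivity)
  refine ⟨sInf S, tendsto_order.2 ⟨fun a ha => ?_, fun a ha => ?_⟩⟩
  · filter_upwards [eventually_ge_atTop 1] with n hn
    exact ha.trans_le (csInf_le hSb ⟨n, hn, rfl⟩)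
  · obtain ⟨_, ⟨k, hk, rfl⟩, hka⟩ := exists_lt_of_csInf_lt hSne ha
    have hlim : Tendsto (fun n : ℕ => b k k / (k : ℝ) ^ 2 + 2 * k * b 1 1 * (1 / (n : ℝ))) atTop
        (𝓝 (b k k / (k : ℝ) ^ 2 + 2 * k * b 1 1 * 0)) :=
      tendsto_const_nhds.add (tendsto_one_div_atTop_nhds_zero_nat.const_mul _)
    rw [mul_zero, add_zero] at hlim
    filter_upwards [hlim.eventually_lt_const hka, eventually_gt_atTop 0] with n hn hn0
    exact (hcut k n hk hn0).trans_lt hn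

/-- The logarithm of twice the volume for the `m × n` grid, which is subadditive in `m` and `n`. The
value `0` for empty grids keeps it so. -/
noncomputable def logVolume (m n : ℕ) : ℝ :=
  if m = 0 ∨ n = 0 then 0 else Real.log (2 * lipVolume (grid m n))

theorem logVolume_succ (m n : ℕ) :
    logVolume (m + 1) (n + 1) = Real.log (2 * lipVolume (grid (m + 1) (n + 1))) := by
  simp [logVolume]

theorem lipVolume_grid_pos (m n : ℕ) : 0 < lipVolume (grid (m + 1) (n + 1)) :=
  zero_lt_one.trans_le (one_le_lipVolume (grid_connected m n))

theorem logVolume_nonneg (m n : ℕ) : 0 ≤ logVolume m n := by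
  rcases m with _ | m
  · simp [logVolume]
  rcases n with _ | n
  · simp [logVolume]
  rw [logVolume_succ]
  have := one_le_lipVolume (grid_connected m n)
  exact Real.log_nonneg (by linarith)

theorem log_two_mul_le {x y z : ℝ} (hx : 0 < x) (hy : 0 < y) (hz : 0 < z) (h : x ≤ y * z * 2) :
    Real.log (2 * x) ≤ Real.log (2 * y) + Real.log (2 * z) := by
  rw [← Real.log_mul (by positivity) (by positivity)]
  exact Real.log_le_log (by positivity) (by linarith)

theorem logVolume_add_left (m₁ m₂ n : ℕ) :
    logVolume (m₁ + m₂) n ≤ logVolume m₁ n + logVolume m₂ n := by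
  rcases n with _ | n
  · simp [logVolume]
  rcases m₁ with _ | m₁
  · rw [zero_add]
    simp [logVolume]
  rcases m₂ with _ | m₂
  · simp [logVolume]
  rw [← add_assoc, logVolume_succ, logVolume_succ, logVolume_succ]
  exact log_two_mul_le (lipVolume_grid_pos _ _) (lipVolume_grid_pos _ _) (lipVolume_grid_pos _ _)
    (lipVolume_grid_add_left m₁ m₂ n)

theorem logVolume_add_right (m n₁ n₂ : ℕ) :
    logVolume m (n₁ + n₂) ≤ logVolume m n₁ + logVolume m n₂ := by
  rcases m with _ | m
  · simp [logVolume]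
  rcases n₁ with _ | n₁
  · rw [zero_add]
    simp [logVolume]
  rcases n₂ with _ | n₂
  · simp [logVolume]
  rw [← add_assoc, logVolume_succ, logVolume_succ, logVolume_succ]
  exact log_two_mul_le (lipVolume_grid_pos _ _) (lipVolume_grid_pos _ _) (lipVolume_grid_pos _ _)
    (lipVolume_grid_add_right m n₁ n₂)

theorem two_le_card_grid {n : ℕ} (hn : 2 ≤ n) : 2 ≤ Fintype.card (Fin n × Fin n) := by
  rw [Fintype.card_prod, Fintype.card_fin]
  nlinarith

theorem grid_connected_of_pos {n : ℕ} (hn : 0 < n) : (grid n n).Connected := by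
  obtain ⟨k, rfl⟩ := Nat.exists_eq_succ_of_ne_zero hn.ne'
  exact grid_connected k k

theorem lipConst_grid_eq {n : ℕ} (hn : 2 ≤ n) :
    lipConst (grid n n) =
      Real.exp ((logVolume n n / (n : ℝ) ^ 2 - Real.log 2 * (1 / (n : ℝ) ^ 2)) *
        (1 / (1 - 1 / (n : ℝ) ^ 2))) := by
  rw [lipConst_eq (grid_connected_of_pos (by omega)) (two_le_card_grid hn), Fintype.card_prod,
    Fintype.card_fin]
  have hn2 : (2 : ℝ) ≤ n := by exact_mod_cast hn
  have hpos : 0 < lipVolume (grid n n) := by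
    obtain ⟨k, rfl⟩ := Nat.exists_eq_succ_of_ne_zero (by omega : n ≠ 0)
    exact lipVolume_grid_pos k k
  have hlog : logVolume n n = Real.log 2 + Real.log (lipVolume (grid n n)) := by
    rw [logVolume, if_neg (by omega), Real.log_mul (by norm_num) hpos.ne']
  have h1 : (n : ℝ) ^ 2 - 1 ≠ 0 := by nlinarith
  rw [Real.rpow_def_of_pos hpos, hlog]
  congr 1
  push_cast
  have h2 : (n : ℝ) * n - 1 ≠ 0 := by rwa [← sq]
  have h3 : 1 - 1 / (n : ℝ) ^ 2 = ((n : ℝ) ^ 2 - 1) / (n : ℝ) ^ 2 := by field_simp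
  rw [h3]
  field_simp
  ring

theorem tendsto_lipConst_grid {L : ℝ}
    (hL : Tendsto (fun n : ℕ => logVolume n n / (n : ℝ) ^ 2) atTop (𝓝 L)) :
    Tendsto (fun n : ℕ => lipConst (grid n n)) atTop (𝓝 (Real.exp L)) := by
  have hsq : Tendsto (fun n : ℕ => 1 / (n : ℝ) ^ 2) atTop (𝓝 0) := by
    have := (tendsto_one_div_atTop_nhds_zero_nat (𝕜 := ℝ)).pow 2
    simpa [one_div, inv_pow] using this
  have h1 : Tendsto (fun n : ℕ => (logVolume n n / (n : ℝ) ^ 2 - Real.log 2 * (1 / (n : ℝ) ^ 2)) *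
      (1 / (1 - 1 / (n : ℝ) ^ 2))) atTop (𝓝 ((L - Real.log 2 * 0) * (1 / (1 - 0)))) :=
    (hL.sub (hsq.const_mul _)).mul
      (tendsto_const_nhds.div (tendsto_const_nhds.sub hsq) (by norm_num))
  rw [mul_zero, sub_zero, sub_zero, div_one, mul_one] at h1
  refine ((Real.continuous_exp.tendsto L).comp h1).congr' ?_
  filter_upwards [eventually_ge_atTop 2] with n hn
  exact (lipConst_grid_eq hn).symm

theorem le_exp_of_tendsto_logVolume {ω : ℝ} (h0 : 0 < ω) (h1 : ω < 1)
    (hω : ω * Real.sin ω = Real.cos ω) {L : ℝ}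
    (hL : Tendsto (fun n : ℕ => logVolume n n / (n : ℝ) ^ 2) atTop (𝓝 L)) :
    (1 / ω) ^ 2 ≤ Real.exp L := by
  have hα : 0 < (1 / ω) ^ 2 := by positivity
  have hpow : Tendsto (fun k : ℕ => 2 ^ k) atTop atTop :=
    tendsto_pow_atTop_atTop_of_one_lt (by norm_num : 1 < 2)
  have hsub := hL.comp ((tendsto_add_atTop_nat 1).comp hpow)
  have hfrac : Tendsto (fun k : ℕ => (((2 ^ k : ℕ) : ℝ) / ((2 ^ k : ℕ) + 1)) ^ 2 *
      Real.log ((1 / ω) ^ 2)) atTop (𝓝 (1 ^ 2 * Real.log ((1 / ω) ^ 2))) :=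
    (((tendsto_natCast_div_add_atTop (1 : ℝ)).comp hpow).pow 2).mul_const _
  rw [one_pow, one_mul] at hfrac
  rw [← Real.log_le_iff_le_exp hα]
  refine le_of_tendsto_of_tendsto' hfrac hsub fun k => ?_
  have hV := lipVolume_grid_two_pow_ge h0 h1 hω (2 ^ k) k
  have hge : ((1 / ω) ^ 2) ^ (2 ^ k * 2 ^ k) ≤ 2 * lipVolume (grid (2 ^ k + 1) (2 ^ k + 1)) := by
    have h2 : (1 : ℝ) ≤ 2 ^ (2 ^ k) := one_le_pow₀ (by norm_num)
    have h3 := le_mul_of_one_le_left (pow_nonneg hα.le (2 ^ k * 2 ^ k)) h2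
    have h4 := lipVolume_grid_pos (2 ^ k) (2 ^ k)
    linarith
  have hlog := Real.log_le_log (by positivity) hge
  rw [Real.log_pow, ← logVolume_succ] at hlog
  simp only [Function.comp_apply]
  rw [div_pow, div_mul_eq_mul_div]
  push_cast at hlog ⊢
  gcongr
  rwa [sq]

end LipschitzGrid

theorem theorem2p2p2 :
    ∃ α : ℝ, IsGreatest {x : ℝ | x ≠ 0 ∧ Real.tan (1 / x) = x} α ∧
      |α ^ 2 - 1.35103| < 0.000005 ∧
      (∀ n : ℕ, 2 ≤ n →
        Filter.Tendsto (LipschitzGrid.lipRate (LipschitzGrid.grid n n)) Filter.atTop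
          (nhds (LipschitzGrid.lipConst (LipschitzGrid.grid n n)))) ∧
      ∃ L : ℝ,
        Filter.Tendsto (fun n : ℕ => LipschitzGrid.lipConst (LipschitzGrid.grid n n))
          Filter.atTop (nhds L) ∧
        α ^ 2 ≤ L := by
  obtain ⟨ω, hω1, hω2, hω⟩ := LipschitzGrid.exists_mul_sin_eq_cos
  have h0 : 0 < ω := by linarith
  have h1 : ω < 1 := by linarith
  have hpi := Real.pi_gt_three
  obtain ⟨L, hL⟩ := LipschitzGrid.exists_tendsto_diag_of_subadditive
    LipschitzGrid.logVolume_nonneg (fun n => by simp [LipschitzGrid.logVolume])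
    (fun m => by simp [LipschitzGrid.logVolume]) LipschitzGrid.logVolume_add_left
    LipschitzGrid.logVolume_add_right
  refine ⟨1 / ω, LipschitzGrid.isGreatest_tan_inv h0 (by linarith) hω,
    LipschitzGrid.abs_inv_sq_sub_lt hω1 hω2, fun n hn => ?_, Real.exp L,
    LipschitzGrid.tendsto_lipConst_grid hL,
    LipschitzGrid.le_exp_of_tendsto_logVolume h0 h1 hω hL⟩
  have hG := LipschitzGrid.grid_connected_of_pos (by omega : 0 < n)
  rw [LipschitzGrid.lipConst_eq hG (LipschitzGrid.two_le_card_grid hn)]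
  exact LipschitzGrid.tendsto_lipRate hG (LipschitzGrid.two_le_card_grid hn)
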